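/- **Setting.** Let $V^1,\dots,V^m$ (state spaces) and $W^1,\dots,W^m$ (spaces of coupling data) be finite-dimensional real normed spaces, and consider the semi-discrete multiphysics system $$M^i\dot u^i=r^i\big(u^i,c^i(u^1,\dots,u^m,t),t\big),\qquad i=1,\dots,m,$$ with invertible mass matrices $M^i$ on $V^i$, velocities $r^i:V^i\times W^i\times\mathbb R\to V^i$ and coupling terms $c^i:V^1\times\dots\times V^m\times\mathbb R\to W^i$. Write it as $M\dot u=r(u,c(u,t),t)$ with $u=(u^1,\dots,u^m)$, $M=\operatorname{diag}(M^1,\dots,M^m)$, $c=(c^1,\dots,c^m)$, $r=(r^1,\dots,r^m)$. *IMEX-RK schemes.* Let $(\hat A,\hat b,\hat c)$ (explicit) and $(A,b,c)$ (diagonally implicit) be an $s$-stage double Butcher tableau. One step of size $h$ for $M\dot u=f(u,t)+g(u,t)$ from $x$ at time $t$ to $y$ is given by $$U_j=x+\sum_{q<j}\hat a_{jq}\hat k_q+\sum_{q\le j}a_{jq}k_q,\quad Mk_j=h\,g(U_j,t+c_jh),\quad M\hat k_j=h\,f(U_j,t+\hat c_jh),\quad y=x+\sum_q\hat b_q\hat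 k_q+\sum_qb_qk_q .$$ The scheme *has order $p$* if for every such split system on a finite-dimensional space with $f,g$ of class $C^{p+1}$ and every solution $u$ on an interval $[t_0,t_0+\varepsilon]$, $\varepsilon>0$, there are $C$, $\delta>0$, $h_0>0$ such that for $0<h\le h_0$ each step from $u(t_0)$ whose stages satisfy $\|U_j-u(t_0)\|\le\delta$ for all $j$ has $\|y-u(t_0+h)\|\le Ch^{p+1}$. *Predictors.* For a state $u$ and data $\bar u$, the four predictors are $\tilde c^i(u,\bar u,t)=c^i(w,t)$, where $w^k=u^k$ for the following $k$ and $w^k=\bar u^k$ for all others: for no $k$ (weak Jacobi); for $k=i$ (strong Jacobi); for $k<i$ (weak Gauss–Seidel); for $k\le i$ (strong Gauss–Seidel). Put $$g_{\bar u}(u,t)=r(u,\tilde c(u,\bar u,t),t),\qquad f_{\bar u}(u,t)=r(u,c(u,t),t)-r(u,\tilde c(u,\bar u,t),t).$$ *Partitioned schemes.* Fix one of the four predictors and numbers $\tau_1,\dots,\tau_s$ (abscissae of the explicit stages). One step of size $h$ of the partitioned scheme from $x$ at time $t$ to $y$ consists, for the stages $j=1,\dots,s$ and the subsystems $i=1,\dots,m$,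 of $$U^i_j=x^i+\sum_{q<j}\hat a_{jq}\hat k^i_q+\sum_{q\le j}a_{jq}k^i_q,\qquad M^ik^i_j=h\,r^i\big(U^i_j,c^i(w_{j,i},t+c_jh),t+c_jh\big),$$ $$M^i\hat k^i_j=h\Big[r^i\big(U^i_j,c^i(U_j,t+\tau_jh),t+\tau_jh\big)-r^i\big(U^i_j,c^i(w_{j,i},t+\tau_jh),t+\tau_jh\big)\Big],$$ and $y^i=x^i+\sum_q\hat b_q\hat k^i_q+\sum_qb_qk^i_q$, where $w_{j,i}$ holds, besides the previous values $x^k$, the already computed stage values $U_j^k$, $k<i$, in the Gauss–Seidel schemes, and also the unknown $U_j^i$ in the strong schemes. **Theorem.** For each of the four predictors: 1. For all $\bar u,u,t$, $\;r(u,c(u,t),t)=f_{\bar u}(u,t)+g_{\bar u}(u,t)$. 2. For all $t,h\in\mathbb R$ and all $x,y$, $U_j,\hat k_j,k_j$, these satisfy the equations of the partitioned step if and only if they satisfy those of the IMEX-RK step, with $\hat c$ replaced by $\tau$, for the monolithic system $M\dot u=f_x(u,t)+g_x(u,t)$. 3. Let $p\ge1$, let the tableau $(\hat A,\hat b,\hat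 c;A,b,c)$ have order $p$, and let either $\tau=\hat c$, or $\tau=c$ and $c_j=\sum_{q\le j}a_{jq}$ for all $j$. Let all $r^i$ and $c^i$ be of class $C^{p+1}$ and let $u$ solve $M\dot u=r(u,c(u,t),t)$ on $[0,\mathcal T]$, $\mathcal T>0$. Then there is a constant $C$ such that for every $\delta>0$ there is $h_0>0$ with the following properties, where only steps whose stages satisfy $\|U_j-x\|\le\delta$ for all $j$ ($x$ being the starting value of the step) are considered. - (Local error) If $0\le t<t+h\le\mathcal T$ and $0<h\le h_0$, then the partitioned step of size $h$ from $u(t)$ at time $t$ has exactly one result $y$, and $\|y-u(t+h)\|\le Ch^{p+1}$. - (Global error) If $0=t_0<\dots<t_N=\mathcal T$ with $t_n-t_{n-1}\le\Delta t\le h_0$ for all $n$, then the partitioned scheme started at $u_0=u(0)$ produces exactly one numerical solution $u_0,\dots,u_N$, and $\|u_n-u(t_n)\|\le C\,\Delta t^p$ for all $n=0,\dots,N$. -/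

import Mathlib

open Set

/-- `u` solves `M u' = F(u, t)` on the time set `J` (one-sided derivatives at end points). -/
def SolvesODE {E : Type} [NormedAddCommGroup E] [NormedSpace ℝ E]
    (M : E ≃L[ℝ] E) (F : E → ℝ → E) (u : ℝ → E) (J : Set ℝ) : Prop :=
  ∀ t ∈ J, ∃ v, HasDerivWithinAt u v J t ∧ M v = F (u t) t

/-- Double Butcher tableau of an `s`-stage implicit-explicit Runge-Kutta scheme: the explicit
coefficients `(Ahat, bhat, chat)` and the diagonally implicit coefficients `(A, b, c)`.
Only the entries of `Ahat` strictly below the diagonal and those of `A` on or below the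
diagonal are ever used. -/
structure IMEXTableau (s : ℕ) where
  Ahat : Fin s → Fin s → ℝ
  bhat : Fin s → ℝ
  chat : Fin s → ℝ
  A : Fin s → Fin s → ℝ
  b : Fin s → ℝ
  c : Fin s → ℝ

/-- The same coefficients, with the explicit stages evaluated at the abscissae `τ`. -/
def IMEXTableau.withExplicitTimes {s : ℕ} (T : IMEXTableau s) (τ : Fin s → ℝ) : IMEXTableau s :=
  { T with chat := τ }

/-- The equations of one step of size `h` of the IMEX-RK scheme for `M u' = f(u, t) + g(u, t)`,
from `x` at time `t` to `y`, with stage approximations `U`, explicit velocity stages `Ke` and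
implicit velocity stages `Ki`. -/
structure IMEXStep {s : ℕ} (T : IMEXTableau s) {E : Type} [NormedAddCommGroup E]
    [NormedSpace ℝ E] (M : E ≃L[ℝ] E) (f g : E → ℝ → E) (t h : ℝ) (x : E)
    (U Ke Ki : Fin s → E) (y : E) : Prop where
  update : y = x + ∑ p, T.bhat p • Ke p + ∑ p, T.b p • Ki p
  impl : ∀ j, M (Ki j) = h • g (U j) (t + T.c j * h)
  expl : ∀ j, M (Ke j) = h • f (U j) (t + T.chat j * h)
  stage : ∀ j, U j = x + ∑ p ∈ Finset.Iio j, T.Ahat j p • Ke p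
    + ∑ p ∈ Finset.Iic j, T.A j p • Ki p

/-- The IMEX-RK scheme has order `p`: for every additively split system of class `C^{p+1}` on a
finite-dimensional space and every solution `u` of it starting at time `t₀`, the error of one step
of size `h` from `u t₀` is `O(h^{p+1})`. All constants may depend on the system and on the
solution. A nonlinear stage equation may have spurious roots that run away as `h → 0`; the step is
the one whose stages are close to the starting value. -/
def IMEXTableau.HasOrder {s : ℕ} (T : IMEXTableau s) (p : ℕ) : Prop :=
  ∀ (E : Type) [NormedAddCommGroup E] [NormedSpace ℝ E] [FiniteDimensional ℝ E]
    (M : E ≃L[ℝ] E) (f g : E → ℝ → E),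
    ContDiff ℝ ((p + 1 : ℕ) : WithTop ℕ∞) (fun z : E × ℝ => f z.1 z.2) →
    ContDiff ℝ ((p + 1 : ℕ) : WithTop ℕ∞) (fun z : E × ℝ => g z.1 z.2) →
    ∀ (u : ℝ → E) (t₀ ε : ℝ), 0 < ε →
      SolvesODE M (fun v t => f v t + g v t) u (Icc t₀ (t₀ + ε)) →
      ∃ C δ h₀ : ℝ, 0 < δ ∧ 0 < h₀ ∧ ∀ h : ℝ, 0 < h → h ≤ h₀ →
        ∀ (U Ke Ki : Fin s → E) (y : E), IMEXStep T M f g t₀ h (u t₀) U Ke Ki y →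
          (∀ j, ‖U j - u t₀‖ ≤ δ) → ‖y - u (t₀ + h)‖ ≤ C * h ^ (p + 1)

/-- The semi-discrete multiphysics system with `m` subsystems,
`Mⁱ (uⁱ)' = rⁱ(uⁱ, cⁱ, t)` with coupling terms `cⁱ = cⁱ(u¹, …, uᵐ, t)`. Here `V i` is the space
of states of the `i`th subsystem and `W i` the space of values of its coupling term. -/
structure MultiphysicsSystem {m : ℕ} (V W : Fin m → Type)
    [∀ i, NormedAddCommGroup (V i)] [∀ i, NormedSpace ℝ (V i)] where
  mass : ∀ i, V i ≃L[ℝ] V i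
  vel : ∀ i, V i → W i → ℝ → V i
  cpl : ∀ i, (∀ k, V k) → ℝ → W i

/-- The four coupling predictors. -/
inductive CouplingPredictor where
  | weakJacobi
  | strongJacobi
  | weakGaussSeidel
  | strongGaussSeidel

namespace MultiphysicsSystem

variable {m : ℕ} {V W : Fin m → Type}
  [∀ i, NormedAddCommGroup (V i)] [∀ i, NormedSpace ℝ (V i)]

/-- The block diagonal mass matrix. -/
def monoMass (S : MultiphysicsSystem V W) : (∀ i, V i) ≃L[ℝ] (∀ i, V i) :=
  ContinuousLinearEquiv.piCongrRight S.mass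

/-- The concatenated velocity `r(u, c, t)`. -/
def monoVel (S : MultiphysicsSystem V W) (u : ∀ i, V i) (c : ∀ i, W i) (t : ℝ) : ∀ i, V i :=
  fun i => S.vel i (u i) (c i) t

/-- The concatenated coupling term `c(u, t)`. -/
def monoCpl (S : MultiphysicsSystem V W) (u : ∀ i, V i) (t : ℝ) : ∀ i, W i :=
  fun i => S.cpl i u t

/-- The velocity `r(u, c(u, t), t)` of the monolithic system. -/
def fullVel (S : MultiphysicsSystem V W) (u : ∀ i, V i) (t : ℝ) : ∀ i, V i :=
  S.monoVel u (S.monoCpl u t) t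

/-- The predicted coupling term as a function of the instantaneous state `u`, of the data `ubar`
and of time. -/
def predictor (S : MultiphysicsSystem V W) (P : CouplingPredictor)
    (u ubar : ∀ i, V i) (t : ℝ) : ∀ i, W i :=
  match P with
  | .weakJacobi => fun i => S.cpl i ubar t
  | .strongJacobi => fun i => S.cpl i (fun k => if k = i then u k else ubar k) t
  | .weakGaussSeidel => fun i => S.cpl i (fun k => if k < i then u k else ubar k) t
  | .strongGaussSeidel => fun i => S.cpl i (fun k => if k ≤ i then u k else ubar k) t

/-- The implicit part of the semi-discrete splitting. -/
def implVel (S : MultiphysicsSystem V W) (P : CouplingPredictor) (ubar : ∀ i, V i)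
    (u : ∀ i, V i) (t : ℝ) : ∀ i, V i :=
  S.monoVel u (S.predictor P u ubar t) t

/-- The explicit part of the semi-discrete splitting: the correction of the predictor. -/
def explVel (S : MultiphysicsSystem V W) (P : CouplingPredictor) (ubar : ∀ i, V i)
    (u : ∀ i, V i) (t : ℝ) : ∀ i, V i :=
  S.monoVel u (S.monoCpl u t) t - S.monoVel u (S.predictor P u ubar t) t

/-- The states of the other subsystems that are at hand when subsystem `i` is solved at a stage:
those of the previous step for the Jacobi schemes; for the Gauss-Seidel schemes the subsystems
before `i` already carry their new stage values `U`. -/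
def available (P : CouplingPredictor) (i : Fin m) (U xprev : ∀ k, V k) : ∀ k, V k :=
  match P with
  | .weakJacobi => xprev
  | .strongJacobi => xprev
  | .weakGaussSeidel => fun k => if k < i then U k else xprev k
  | .strongGaussSeidel => fun k => if k < i then U k else xprev k

/-- The state at which the `i`th coupling term is evaluated when subsystem `i` is solved: the
strong schemes insert the unknown stage value `U i` of that subsystem. -/
def couplingState (P : CouplingPredictor) (i : Fin m) (U xprev : ∀ k, V k) : ∀ k, V k :=
  match P with
  | .weakJacobi => available P i U xprev
  | .strongJacobi => Function.update (available P i U xprev) i (U i)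
  | .weakGaussSeidel => available P i U xprev
  | .strongGaussSeidel => Function.update (available P i U xprev) i (U i)

/-- The equations of one step of the partitioned scheme, subsystem by subsystem, from `x` at time
`t` to `y`; `U j i`, `Ke j i`, `Ki j i` belong to stage `j` and subsystem `i`. -/
structure PartitionedStep {s : ℕ} (S : MultiphysicsSystem V W) (T : IMEXTableau s)
    (P : CouplingPredictor) (t h : ℝ) (x : ∀ i, V i) (U Ke Ki : Fin s → ∀ i, V i)
    (y : ∀ i, V i) : Prop where
  stage : ∀ j i, U j i = x i + ∑ p ∈ Finset.Iio j, T.Ahat j p • Ke p i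
    + ∑ p ∈ Finset.Iic j, T.A j p • Ki p i
  impl : ∀ j i, S.mass i (Ki j i) = h • S.vel i (U j i)
    (S.cpl i (couplingState P i (U j) x) (t + T.c j * h)) (t + T.c j * h)
  expl : ∀ j i, S.mass i (Ke j i) = h •
    (S.vel i (U j i) (S.cpl i (U j) (t + T.chat j * h)) (t + T.chat j * h)
      - S.vel i (U j i) (S.cpl i (couplingState P i (U j) x) (t + T.chat j * h))
          (t + T.chat j * h))
  update : ∀ i, y i = x i + ∑ p, T.bhat p • Ke p i + ∑ p, T.b p • Ki p i

/-- The partitioned scheme carries `x` to `y` with all stages within distance `δ` of `x`. -/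
def StepsTo {s : ℕ} (S : MultiphysicsSystem V W) (T : IMEXTableau s)
    (P : CouplingPredictor) (δ t h : ℝ) (x y : ∀ i, V i) : Prop :=
  ∃ U Ke Ki : Fin s → ∀ i, V i, S.PartitionedStep T P t h x U Ke Ki y ∧ ∀ j, ‖U j - x‖ ≤ δ

/-- `v` is a numerical solution on the time grid `tg` with initial value `x₀`. -/
def IsRun {s : ℕ} (S : MultiphysicsSystem V W) (T : IMEXTableau s)
    (P : CouplingPredictor) (δ : ℝ) {N : ℕ} (tg : Fin (N + 1) → ℝ) (x₀ : ∀ i, V i)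
    (v : Fin (N + 1) → ∀ i, V i) : Prop :=
  v 0 = x₀ ∧ ∀ n : Fin N,
    S.StepsTo T P δ (tg n.castSucc) (tg n.succ - tg n.castSucc) (v n.castSucc) (v n.succ)

end MultiphysicsSystem

/-! With the coupling data frozen at the starting value `x`, the partitioned equations are the
components of the IMEX-RK equations for the splitting `f_x + g_x`, since the mass matrix is block
diagonal. The sum of the two parts does not depend on `x`, so freezing at `u t` gives a fixed split
system that `u` still solves, and the order hypothesis applies to the step from `u t`.

That yields a local error bound whose constant and step size may depend on `t`; the main difficulty
is uniformity. Finitely many Picard iterations of the stage equations show that the numerical result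
has a Taylor polynomial in `h` with remainder `O(h^(p+1))`, uniformly on balls
(`OneStep.exists_taylor_bound`); the exact solution has one uniformly in `t`
(`exists_taylor_bound_Icc`). The pointwise bound forces the two polynomials to coincide, so only the
uniform remainders survive (`OneStep.exists_local_error_bound`).

The global bound follows from stability by a discrete Gronwall argument, which also keeps the
numerical solution in the tube where steps are uniquely solvable (`existsUnique_run_and_error_le`).
Stages within any `δ` of `x` are in fact `O(h)`-close to `x`, so `δ` influences only the admissible
step size. The abscissae `τ = c` are reduced to the given tableau by treating time as an implicit
component. -/

/-! ### Taylor expansions, local Lipschitz bounds and regularity of solutions -/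

open Filter Topology in
/-- A polynomial of degree less than `n` that is `O(h ^ n)` as `h → 0+` vanishes. -/
theorem eq_zero_of_norm_sum_pow_smul_le {E : Type*} [NormedAddCommGroup E] [NormedSpace ℝ E]
    {h₀ C : ℝ} (hh₀ : 0 < h₀) {n : ℕ} {a : ℕ → E}
    (H : ∀ h, 0 < h → h ≤ h₀ → ‖∑ k ∈ Finset.range n, h ^ k • a k‖ ≤ C * h ^ n) :
    ∀ k < n, a k = 0 := by
  induction n generalizing a with
  | zero => simp
  | succ n ih =>
    have h0 : a 0 = 0 := by
      have hev : ∀ᶠ h : ℝ in 𝓝[>] 0, ‖∑ k ∈ Finset.range (n + 1), h ^ k • a k‖ ≤ C * h ^ (n + 1) := by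
        filter_upwards [Ioc_mem_nhdsGT hh₀] with h hh using H h hh.1 hh.2
      have h1 : Tendsto (fun h : ℝ => ‖∑ k ∈ Finset.range (n + 1), h ^ k • a k‖) (𝓝[>] 0)
          (𝓝 ‖a 0‖) := by
        have : Continuous fun h : ℝ => ‖∑ k ∈ Finset.range (n + 1), h ^ k • a k‖ := by fun_prop
        have := this.tendsto 0
        simp only [Finset.sum_range_succ', pow_zero, one_smul] at this ⊢
        simp at this
        exact this.mono_left nhdsWithin_le_nhds
      have h2 : Tendsto (fun h : ℝ => C * h ^ (n + 1)) (𝓝[>] 0) (𝓝 0) := by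
        have : Continuous fun h : ℝ => C * h ^ (n + 1) := by fun_prop
        have := this.tendsto 0
        simp at this
        exact this.mono_left nhdsWithin_le_nhds
      exact norm_le_zero_iff.1 (le_of_tendsto_of_tendsto h1 h2 hev)
    -- Once the constant term is gone, a factor `h` cancels on both sides.
    have hs : ∀ k < n, a (k + 1) = 0 := by
      refine ih (a := fun k => a (k + 1)) fun h hh hh' => ?_
      have := H h hh hh'
      rw [Finset.sum_range_succ', h0, smul_zero, add_zero] at this
      simp only [pow_succ', mul_smul] at this
      rw [← Finset.smul_sum, norm_smul, Real.norm_of_nonneg hh.le, mul_left_comm] at this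
      exact le_of_mul_le_mul_left this hh
    rintro (_ | k) hk
    · exact h0
    · exact hs k (by omega)

/-- Taylor expansion in time of a `C^(n+1)` curve on `[0, b]`, uniformly in the base point. -/
theorem exists_taylor_bound_Icc {E : Type*} [NormedAddCommGroup E] [NormedSpace ℝ E]
    {n : ℕ} {b : ℝ} {u : ℝ → E} (hu : ContDiffOn ℝ ((n + 1 : ℕ) : WithTop ℕ∞) u (Icc 0 b)) :
    ∃ (C : ℝ) (a : ℝ → ℕ → E), ∀ t h, 0 ≤ t → 0 < h → t + h ≤ b →
      ‖u (t + h) - ∑ k ∈ Finset.range (n + 1), h ^ k • a t k‖ ≤ C * h ^ (n + 1) := by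
  rcases le_or_gt b 0 with hb | hb
  · exact ⟨0, fun _ _ => 0, fun t h ht hh hth => by linarith⟩
  have hU := uniqueDiffOn_Icc hb
  obtain ⟨C, hC⟩ := isCompact_Icc.exists_bound_of_continuousOn
    (hu.continuousOn_iteratedDerivWithin le_rfl hU)
  -- The expansion is made at the left end of `Icc t b`. Derivatives within it agree with those
  -- within `Icc 0 b`, so one compactness bound `C` serves every `t`.
  refine ⟨C / n.factorial, fun t k => (k.factorial : ℝ)⁻¹ • iteratedDerivWithin k u (Icc t b) t,
    fun t h ht hh hth => ?_⟩
  have htb : t < b := by linarith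
  have hsub : Icc t b ⊆ Icc 0 b := Icc_subset_Icc_left ht
  have := taylor_mean_remainder_bound (n := n) (x := t + h) (C := C) htb.le
    (by exact_mod_cast hu.mono hsub) ⟨by linarith, hth⟩ (fun y hy => by
      have := hC y (hsub hy)
      rwa [iteratedDerivWithin, iteratedFDerivWithin_subset hsub (uniqueDiffOn_Icc htb) hU hu hy])
  rw [taylor_within_apply] at this
  simp only [add_sub_cancel_left] at this
  rw [div_mul_eq_mul_div]
  refine le_trans (le_of_eq ?_) this
  congr 2
  refine Finset.sum_congr rfl fun k _ => ?_
  rw [smul_smul, mul_comm]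

/-- Taylor expansion of a `C^(n+1)` function in its first variable, uniformly for the second
variable in a compact set. -/
theorem exists_taylor_bound_of_isCompact {X E : Type*} [NormedAddCommGroup X] [NormedSpace ℝ X]
    [NormedAddCommGroup E] [NormedSpace ℝ E] {n : ℕ} {f : ℝ × X → E}
    (hf : ContDiff ℝ ((n + 1 : ℕ) : WithTop ℕ∞) f) {K : Set X} (hK : IsCompact K) :
    ∃ (C : ℝ) (a : X → ℕ → E), ∀ x ∈ K, ∀ h, 0 < h → h ≤ 1 →
      ‖f (h, x) - ∑ k ∈ Finset.range (n + 1), h ^ k • a x k‖ ≤ C * h ^ (n + 1) := by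
  obtain ⟨C, hC⟩ := (isCompact_Icc (a := (0 : ℝ)) (b := 1)).prod hK |>.exists_bound_of_continuousOn
    (hf.continuous_iteratedFDeriv le_rfl).continuousOn
  refine ⟨C / n.factorial,
    fun x k => (k.factorial : ℝ)⁻¹ • iteratedDerivWithin k (fun h => f (h, x)) (Icc 0 1) 0,
    fun x hx h hh hh1 => ?_⟩
  have hfx : ContDiff ℝ ((n + 1 : ℕ) : WithTop ℕ∞) (fun h => f (h, x)) := by fun_prop
  have key : ∀ y ∈ Icc (0 : ℝ) 1,
      ‖iteratedDerivWithin (n + 1) (fun h => f (h, x)) (Icc 0 1) y‖ ≤ C := by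
    intro y hy
    rw [iteratedDerivWithin_eq_iteratedDeriv (uniqueDiffOn_Icc one_pos) hfx.contDiffAt hy,
      ← norm_iteratedFDeriv_eq_norm_iteratedDeriv]
    -- Derivatives in `h` alone are full derivatives of `f` composed with the inclusion `inl`, whose
    -- norm is at most 1.
    have e : (fun h => f (h, x)) =
        (fun z => f (z + (0, x))) ∘ ContinuousLinearMap.inl ℝ ℝ X := by
      ext h; simp
    have hft : ContDiff ℝ ((n + 1 : ℕ) : WithTop ℕ∞) (fun z => f (z + (0, x))) := by fun_prop
    rw [e, ContinuousLinearMap.iteratedFDeriv_comp_right _ hft _ le_rfl]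
    refine (ContinuousMultilinearMap.norm_compContinuousLinearMap_le _ _).trans ?_
    rw [iteratedFDeriv_comp_add_right]
    have h1 : ‖ContinuousLinearMap.inl ℝ ℝ X‖ ≤ 1 := ContinuousLinearMap.norm_inl_le_one ℝ ℝ X
    have h2 := hC (y, x) ⟨hy, hx⟩
    calc _ ≤ ‖iteratedFDeriv ℝ (n + 1) f (y, x)‖ * 1 := by
          simp only [Finset.prod_const, ContinuousLinearMap.inl_apply, Prod.mk_add_mk, add_zero,
            zero_add]
          gcongr
          exact pow_le_one₀ (norm_nonneg _) h1
      _ ≤ C := by rwa [mul_one]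
  have := taylor_mean_remainder_bound (n := n) (x := h) (C := C) zero_le_one
    (by exact_mod_cast hfx.contDiffOn) ⟨hh.le, hh1⟩ key
  rw [taylor_within_apply] at this
  simp only [sub_zero] at this
  rw [div_mul_eq_mul_div]
  refine le_trans (le_of_eq ?_) this
  congr 2
  refine Finset.sum_congr rfl fun k _ => ?_
  rw [smul_smul, mul_comm]

/-- A `C¹` function on a finite-dimensional space is bounded and Lipschitz on balls. -/
theorem ContDiff.exists_bound_lipschitz_closedBall {X Y : Type*} [NormedAddCommGroup X]
    [NormedSpace ℝ X] [FiniteDimensional ℝ X] [NormedAddCommGroup Y] [NormedSpace ℝ Y]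
    {f : X → Y} (hf : ContDiff ℝ 1 f) (R : ℝ) :
    ∃ L : ℝ, 0 ≤ L ∧ (∀ z, ‖z‖ ≤ R → ‖f z‖ ≤ L) ∧
      ∀ z z', ‖z‖ ≤ R → ‖z'‖ ≤ R → ‖f z - f z'‖ ≤ L * ‖z - z'‖ := by
  have : ProperSpace X := FiniteDimensional.proper ℝ X
  have hc : IsCompact (Metric.closedBall (0 : X) R) := isCompact_closedBall _ _
  obtain ⟨C, hC⟩ := hc.exists_bound_of_continuousOn hf.continuous.continuousOn
  obtain ⟨K, hK⟩ := hf.contDiffOn.exists_lipschitzOnWith one_ne_zero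
    (convex_closedBall (0 : X) R) hc
  refine ⟨max C K, le_max_of_le_right K.2, fun z hz => (hC z (by simpa using hz)).trans
    (le_max_left _ _), fun z z' hz hz' => ?_⟩
  have := hK.dist_le_mul z (by simpa using hz) z' (by simpa using hz')
  rw [dist_eq_norm, dist_eq_norm] at this
  exact this.trans (by gcongr; exact le_max_right _ _)

/-- Solutions of a `C^n` differential equation are `C^n`. -/
theorem SolvesODE.contDiffOn {E : Type} [NormedAddCommGroup E] [NormedSpace ℝ E]
    {M : E ≃L[ℝ] E} {F : E → ℝ → E} {u : ℝ → E} {b : ℝ} (hb : 0 < b) {n : ℕ}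
    (hF : ContDiff ℝ (n : WithTop ℕ∞) (fun z : E × ℝ => F z.1 z.2))
    (hu : SolvesODE M F u (Icc 0 b)) : ContDiffOn ℝ (n : WithTop ℕ∞) u (Icc 0 b) := by
  have hd : ∀ t ∈ Icc 0 b, HasDerivWithinAt u (M.symm (F (u t) t)) (Icc 0 b) t := by
    intro t ht
    obtain ⟨v, hv, hv'⟩ := hu t ht
    rwa [← hv', M.symm_apply_apply]
  have hU := uniqueDiffOn_Icc hb
  induction n with
  | zero =>
    exact contDiffOn_zero.2 fun t ht => (hd t ht).continuousWithinAt
  | succ n ih =>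
    have hF' := hF.of_le (m := (n : WithTop ℕ∞)) (by exact_mod_cast n.le_succ)
    have hn := ih hF'
    rw [Nat.cast_succ, contDiffOn_succ_iff_derivWithin hU]
    refine ⟨fun t ht => (hd t ht).differentiableWithinAt, by simp, ?_⟩
    -- Bootstrapping: a `C^n` solution has a `C^n` right-hand side, which is its derivative.
    have : ContDiffOn ℝ (n : WithTop ℕ∞) (fun t => M.symm (F (u t) t)) (Icc 0 b) :=
      M.symm.contDiff.comp_contDiffOn (hF'.comp_contDiffOn (hn.prodMk contDiffOn_id))
    exact this.congr fun t ht => (hd t ht).derivWithin (hU t ht)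

/-! ### Implicit one-step methods: solvability and stability on a fixed ball -/

/-- The implicit one-step method with stage equations `U = x + h G(U, h, x, t)` and update
`y = x + h B(U, h, x, t)`, restricted to stages within distance `δ` of `x`. -/
def OneStep {s : ℕ} {E : Type*} [NormedAddCommGroup E] [NormedSpace ℝ E]
    (G : (Fin s → E) × ℝ × E × ℝ → Fin s → E) (B : (Fin s → E) × ℝ × E × ℝ → E)
    (δ t h : ℝ) (x y : E) : Prop :=
  ∃ U : Fin s → E, U = (fun _ => x) + h • G (U, h, x, t) ∧ y = x + h • B (U, h, x, t) ∧
    ‖U - fun _ => x‖ ≤ δ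

/-- `L` bounds `G` and the Lipschitz constants of `G` and `B` on the ball of radius `R`. -/
structure StepBounds {X Y Z : Type*} [NormedAddCommGroup X] [NormedAddCommGroup Y]
    [NormedAddCommGroup Z] (G : X → Y) (B : X → Z) (R L : ℝ) : Prop where
  nonneg : 0 ≤ L
  bound : ∀ z, ‖z‖ ≤ R → ‖G z‖ ≤ L
  lipG : ∀ z z', ‖z‖ ≤ R → ‖z'‖ ≤ R → ‖G z - G z'‖ ≤ L * ‖z - z'‖
  lipB : ∀ z z', ‖z‖ ≤ R → ‖z'‖ ≤ R → ‖B z - B z'‖ ≤ L * ‖z - z'‖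

theorem StepBounds.exists {X Y Z : Type*} [NormedAddCommGroup X] [NormedSpace ℝ X]
    [FiniteDimensional ℝ X] [NormedAddCommGroup Y] [NormedSpace ℝ Y]
    [NormedAddCommGroup Z] [NormedSpace ℝ Z] {G : X → Y} {B : X → Z} (hG : ContDiff ℝ 1 G)
    (hB : ContDiff ℝ 1 B) (R : ℝ) : ∃ L, StepBounds G B R L := by
  obtain ⟨L, hL, h1, h2⟩ := hG.exists_bound_lipschitz_closedBall R
  obtain ⟨L', hL', -, h3⟩ := hB.exists_bound_lipschitz_closedBall R
  refine ⟨L + L', by positivity, fun z hz => (h1 z hz).trans (by linarith), fun z z' hz hz' =>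
    (h2 z z' hz hz').trans ?_, fun z z' hz hz' => (h3 z z' hz hz').trans ?_⟩ <;>
  · gcongr
    linarith

theorem norm_point_sub_le {s : ℕ} {E : Type*} [NormedAddCommGroup E]
    (U U' : Fin s → E) (h t : ℝ) (x x' : E) :
    ‖(U, h, x, t) - (U', h, x', t)‖ ≤ ‖U - U'‖ + ‖x - x'‖ := by
  simp only [Prod.norm_def, Prod.mk_sub_mk, sub_self, norm_zero, sup_le_iff]
  have := norm_nonneg (U - U')
  have := norm_nonneg (x - x')
  exact ⟨by linarith, by linarith, by linarith, by linarith⟩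

theorem norm_stage_point_le {s : ℕ} {E : Type*} [NormedAddCommGroup E]
    {R ρ t h : ℝ} {x : E} {U : Fin s → E} (hρ : 0 ≤ ρ)
    (hU : ‖U - fun _ => x‖ ≤ ρ) (hh : |h| ≤ R) (hx : ‖x‖ ≤ R) (ht : |t| ≤ R) : ‖(U, h, x, t)‖ ≤ R + ρ := by
  have h1 : ‖U‖ ≤ R + ρ := by
    have := norm_add_le (U - fun _ => x) (fun _ => x)
    rw [sub_add_cancel] at this
    linarith [pi_norm_const_le (ι := Fin s) x]
  simp only [Prod.norm_def, Real.norm_eq_abs, sup_le_iff]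
  exact ⟨h1, by linarith, by linarith, by linarith⟩

section

variable {s : ℕ} {E : Type*} [NormedAddCommGroup E] [NormedSpace ℝ E]
  {G : (Fin s → E) × ℝ × E × ℝ → Fin s → E} {B : (Fin s → E) × ℝ × E × ℝ → E}
  {R ρ L δ t h : ℝ} {x x' y y' : E} {U U' : Fin s → E}

/-- This gives invariance of the ball for the fixed-point argument and, applied to actual stages,
the a priori estimate that removes the dependence on `δ`. -/
theorem norm_stage_sub_le (hb : StepBounds G B (R + ρ) L) (hρ : 0 ≤ ρ) (h0 : 0 ≤ h) (hR : h ≤ R)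
    (hx : ‖x‖ ≤ R) (ht : |t| ≤ R) (hUρ : ‖U - fun _ => x‖ ≤ ρ) :
    ‖((fun _ => x) + h • G (U, h, x, t)) - fun _ => x‖ ≤ h * L := by
  rw [add_sub_cancel_left, norm_smul, Real.norm_of_nonneg h0]
  gcongr
  exact hb.bound _ (norm_stage_point_le hρ hUρ (by rwa [abs_of_nonneg h0]) hx ht)

/-- Difference of two stage maps. -/
theorem norm_stage_map_sub_le (hb : StepBounds G B (R + ρ) L) (hρ : 0 ≤ ρ) (h0 : 0 ≤ h)
    (hR : h ≤ R) (hx : ‖x‖ ≤ R) (hx' : ‖x'‖ ≤ R) (ht : |t| ≤ R) (hUρ : ‖U - fun _ => x‖ ≤ ρ)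
    (hUρ' : ‖U' - fun _ => x'‖ ≤ ρ) :
    ‖((fun _ => x) + h • G (U, h, x, t)) - ((fun _ => x') + h • G (U', h, x', t))‖ ≤
      ‖x - x'‖ + h * L * (‖U - U'‖ + ‖x - x'‖) := by
  have hh : |h| ≤ R := by rwa [abs_of_nonneg h0]
  have e : ((fun _ => x) + h • G (U, h, x, t)) - ((fun _ => x') + h • G (U', h, x', t)) =
      (fun _ => x - x') + h • (G (U, h, x, t) - G (U', h, x', t)) := by
    ext j; simp only [Pi.add_apply, Pi.sub_apply, Pi.smul_apply, smul_sub]; abel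
  rw [e]
  refine (norm_add_le _ _).trans (add_le_add (pi_norm_const_le _) ?_)
  rw [norm_smul, Real.norm_of_nonneg h0, mul_assoc]
  gcongr
  refine (hb.lipG _ _ (norm_stage_point_le hρ hUρ hh hx ht)
    (norm_stage_point_le hρ hUρ' hh hx' ht)).trans ?_
  have := hb.nonneg
  gcongr
  exact norm_point_sub_le ..

theorem stage_unique (hb : StepBounds G B (R + ρ) L) (hρ : 0 ≤ ρ) (h0 : 0 ≤ h) (hR : h ≤ R)
    (hL : h * L ≤ 1 / 2) (hx : ‖x‖ ≤ R) (ht : |t| ≤ R) (hUρ : ‖U - fun _ => x‖ ≤ ρ)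
    (hUρ' : ‖U' - fun _ => x‖ ≤ ρ) (hU : U = (fun _ => x) + h • G (U, h, x, t))
    (hU' : U' = (fun _ => x) + h • G (U', h, x, t)) : U = U' := by
  have := norm_stage_map_sub_le hb hρ h0 hR hx hx ht hUρ hUρ'
  rw [← hU, ← hU', sub_self, norm_zero, add_zero, zero_add] at this
  have h3 : h * L * ‖U - U'‖ ≤ 1 / 2 * ‖U - U'‖ := by gcongr
  exact sub_eq_zero.1 (norm_le_zero_iff.1 (by linarith))

/-- Banach's fixed-point theorem on the closed `ρ`-ball around the constant stages: `h * L ≤ ρ`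
makes it invariant, `h * L ≤ 1 / 2` makes the stage map a contraction. -/
theorem exists_stage [CompleteSpace E] (hb : StepBounds G B (R + ρ) L) (hρ : 0 ≤ ρ) (h0 : 0 ≤ h)
    (hR : h ≤ R) (hL : h * L ≤ 1 / 2) (hLρ : h * L ≤ ρ) (hx : ‖x‖ ≤ R) (ht : |t| ≤ R) :
    ∃ U : Fin s → E, U = (fun _ => x) + h • G (U, h, x, t) ∧ ‖U - fun _ => x‖ ≤ ρ := by
  let Ψ : (Fin s → E) → Fin s → E := fun U => (fun _ => x) + h • G (U, h, x, t)
  let S : Set (Fin s → E) := Metric.closedBall (fun _ => x) ρ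
  have hS : ∀ {U}, U ∈ S ↔ ‖U - fun _ => x‖ ≤ ρ := by
    intro U; simp only [S, Metric.mem_closedBall, dist_eq_norm]
  have hm : MapsTo Ψ S S := fun U hU =>
    hS.2 ((norm_stage_sub_le hb hρ h0 hR hx ht (hS.1 hU)).trans hLρ)
  have hc : ContractingWith (1 / 2) (hm.restrict Ψ S S) := by
    refine ⟨by rw [one_div]; exact inv_lt_one_of_one_lt₀ (by norm_num),
      LipschitzWith.of_dist_le_mul fun U U' => ?_⟩
    rw [Subtype.dist_eq, Subtype.dist_eq, dist_eq_norm, dist_eq_norm]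
    have := norm_stage_map_sub_le hb hρ h0 hR hx hx ht (hS.1 U.2) (hS.1 U'.2)
    rw [sub_self, norm_zero, add_zero, zero_add] at this
    refine this.trans ?_
    simp only [NNReal.coe_div, NNReal.coe_one, NNReal.coe_ofNat]
    gcongr
  obtain ⟨U, hU, hfix, -⟩ := hc.exists_fixedPoint' Metric.isClosed_closedBall.isComplete hm
    (x := fun _ => x) (Metric.mem_closedBall_self hρ) (edist_ne_top _ _)
  exact ⟨U, hfix.symm, hS.1 hU⟩

/-- Lipschitz dependence of the result of a step on the starting value. -/
theorem norm_step_sub_le (hb : StepBounds G B (R + ρ) L) (hρ : 0 ≤ ρ) (h0 : 0 ≤ h) (hR : h ≤ R)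
    (hL : h * L ≤ 1 / 2) (hx : ‖x‖ ≤ R) (hx' : ‖x'‖ ≤ R) (ht : |t| ≤ R)
    (hy : OneStep G B ρ t h x y) (hy' : OneStep G B ρ t h x' y') :
    ‖y - y'‖ ≤ (1 + 4 * L * h) * ‖x - x'‖ := by
  obtain ⟨U, hU, rfl, hUρ⟩ := hy
  obtain ⟨U', hU', rfl, hUρ'⟩ := hy'
  have hh : |h| ≤ R := by rwa [abs_of_nonneg h0]
  have h1 := norm_stage_map_sub_le hb hρ h0 hR hx hx' ht hUρ hUρ'
  rw [← hU, ← hU'] at h1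
  have h2 : h * L * (‖U - U'‖ + ‖x - x'‖) ≤ 1 / 2 * (‖U - U'‖ + ‖x - x'‖) := by gcongr
  -- Absorbing the half of `‖U - U'‖` on the right gives `‖U - U'‖ ≤ 3 * ‖x - x'‖`; hence the factor
  -- 4.
  have h3 : ‖U - U'‖ + ‖x - x'‖ ≤ 4 * ‖x - x'‖ := by linarith
  have e : x + h • B (U, h, x, t) - (x' + h • B (U', h, x', t)) =
      (x - x') + h • (B (U, h, x, t) - B (U', h, x', t)) := by rw [smul_sub]; abel
  have hL0 := hb.nonneg
  calc _ ≤ ‖x - x'‖ + h * (L * (4 * ‖x - x'‖)) := by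
        rw [e]
        refine (norm_add_le _ _).trans ?_
        rw [norm_smul, Real.norm_of_nonneg h0]
        gcongr
        refine (hb.lipB _ _ (norm_stage_point_le hρ hUρ hh hx ht)
          (norm_stage_point_le hρ hUρ' hh hx' ht)).trans ?_
        gcongr
        exact (norm_point_sub_le ..).trans h3
    _ = _ := by ring

/-! ### Picard approximation of the stages -/

/-- Picard iterates of the stage equations, as functions of step size and starting point. -/
def picardStage (G : (Fin s → E) × ℝ × E × ℝ → Fin s → E) : ℕ → ℝ × E × ℝ → Fin s → E
  | 0 => fun w _ => w.2.1
  | n + 1 => fun w => (fun _ => w.2.1) + w.1 • G (picardStage G n w, w)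

theorem contDiff_picardStage {k : WithTop ℕ∞} (hG : ContDiff ℝ k G) (n : ℕ) :
    ContDiff ℝ k (picardStage G n) := by
  have h0 : ContDiff ℝ k (fun w : ℝ × E × ℝ => (fun _ => w.2.1 : Fin s → E)) :=
    contDiff_pi.2 fun _ => contDiff_fst.comp contDiff_snd
  induction n with
  | zero => exact h0
  | succ n ih => exact h0.add (contDiff_fst.smul (hG.comp (ih.prodMk contDiff_id)))

theorem norm_picardStage_sub_le (hb : StepBounds G B (R + 1) L) (h0 : 0 ≤ h) (hR : h ≤ R)
    (hL : h * L ≤ 1) (hx : ‖x‖ ≤ R) (ht : |t| ≤ R) (n : ℕ) :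
    ‖picardStage G n (h, x, t) - fun _ => x‖ ≤ 1 := by
  induction n with
  | zero => simp [picardStage]
  | succ n ih => exact (norm_stage_sub_le hb zero_le_one h0 hR hx ht ih).trans hL

/-- Exact stages are a fixed point of the stage map, so each iteration gains a factor `h * L`,
starting from the distance `h * L` to the constant stages. -/
theorem norm_stage_sub_picardStage_le (hb : StepBounds G B (R + 1) L) (h0 : 0 ≤ h) (hR : h ≤ R)
    (hL : h * L ≤ 1) (hx : ‖x‖ ≤ R) (ht : |t| ≤ R) (hU1 : ‖U - fun _ => x‖ ≤ 1)
    (hU : U = (fun _ => x) + h • G (U, h, x, t)) (n : ℕ) :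
    ‖U - picardStage G n (h, x, t)‖ ≤ (h * L) ^ (n + 1) := by
  induction n with
  | zero =>
    have := norm_stage_sub_le hb zero_le_one h0 hR hx ht hU1
    rwa [← hU, ← pow_one (h * L)] at this
  | succ n ih =>
    have := norm_stage_map_sub_le hb zero_le_one h0 hR hx hx ht hU1
      (norm_picardStage_sub_le hb h0 hR hL hx ht n)
    rw [← hU, sub_self, norm_zero, add_zero, zero_add] at this
    refine this.trans ?_
    rw [pow_succ' _ (n + 1)]
    have := hb.nonneg
    gcongr

end

/-! ### Uniform solvability, stability and local error on balls -/

section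

variable {s : ℕ} {E : Type*} [NormedAddCommGroup E] [NormedSpace ℝ E] [FiniteDimensional ℝ E]
  {G : (Fin s → E) × ℝ × E × ℝ → Fin s → E} {B : (Fin s → E) × ℝ × E × ℝ → E}

/-- The stages of a step of small size, if within distance `δ` of `x`, are within distance `ρ`. -/
theorem OneStep.exists_restrict (hG : ContDiff ℝ 1 G) (hB : ContDiff ℝ 1 B) {R : ℝ} (hR : 1 ≤ R)
    {δ ρ : ℝ} (hδ : 0 < δ) (hρ : 0 < ρ) : ∃ h₀ : ℝ, 0 < h₀ ∧ ∀ t h x y, |t| ≤ R → ‖x‖ ≤ R → 0 < h →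
      h ≤ h₀ → OneStep G B δ t h x y → OneStep G B ρ t h x y := by
  obtain ⟨L, hb⟩ := StepBounds.exists hG hB (R + δ)
  have hL := hb.nonneg
  refine ⟨min 1 (ρ / (L + 1)), by positivity, fun t h x y ht hx h0 hh => ?_⟩
  rintro ⟨U, hU, hy, hUδ⟩
  refine ⟨U, hU, hy, ?_⟩
  have := norm_stage_sub_le hb hδ.le h0.le ((hh.trans (min_le_left _ _)).trans hR) hx ht hUδ
  rw [← hU] at this
  refine this.trans ?_
  calc h * L ≤ ρ / (L + 1) * (L + 1) := by
        gcongr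
        · exact hh.trans (min_le_right _ _)
        · linarith
    _ = ρ := by field_simp

/-- Unique solvability of the steps, uniformly on balls. -/
theorem OneStep.existsUnique (hG : ContDiff ℝ 1 G) (hB : ContDiff ℝ 1 B) {R : ℝ} (hR : 1 ≤ R)
    {δ : ℝ} (hδ : 0 < δ) : ∃ h₀ : ℝ, 0 < h₀ ∧ ∀ t h x, |t| ≤ R → ‖x‖ ≤ R → 0 < h →
      h ≤ h₀ → ∃! y, OneStep G B δ t h x y := by
  obtain ⟨L, hb⟩ := StepBounds.exists hG hB (R + δ)
  have hL := hb.nonneg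
  have : CompleteSpace E := FiniteDimensional.complete ℝ E
  refine ⟨min 1 (min (1 / 2) δ / (L + 1)), by positivity, fun t h x ht hx h0 hh => ?_⟩
  have hhR := (hh.trans (min_le_left _ _)).trans hR
  have hhL : h * L ≤ min (1 / 2) δ := by
    calc h * L ≤ min (1 / 2) δ / (L + 1) * (L + 1) := by
          gcongr
          · exact hh.trans (min_le_right _ _)
          · linarith
      _ = min (1 / 2) δ := by field_simp
  have h12 := hhL.trans (min_le_left _ _)
  obtain ⟨U, hU, hUδ⟩ := exists_stage hb hδ.le h0.le hhR h12 (hhL.trans (min_le_right _ _)) hx ht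
  refine ⟨_, ⟨U, hU, rfl, hUδ⟩, ?_⟩
  rintro _ ⟨U', hU', rfl, hUδ'⟩
  rw [stage_unique hb hδ.le h0.le hhR h12 hx ht hUδ' hUδ hU' hU]

/-- Stability of the steps, uniformly on balls. -/
theorem OneStep.exists_lipschitz (hG : ContDiff ℝ 1 G) (hB : ContDiff ℝ 1 B) {R : ℝ} (hR : 1 ≤ R) :
    ∃ L : ℝ, 0 ≤ L ∧ ∀ δ : ℝ, 0 < δ → ∃ h₀ : ℝ, 0 < h₀ ∧ ∀ t h x x' y y', |t| ≤ R → ‖x‖ ≤ R →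
      ‖x'‖ ≤ R → 0 < h → h ≤ h₀ → OneStep G B δ t h x y → OneStep G B δ t h x' y' →
      ‖y - y'‖ ≤ (1 + L * h) * ‖x - x'‖ := by
  -- The radius is fixed before `δ` is given; `OneStep.exists_restrict` then moves the stages into
  -- the unit ball, at the cost of a smaller `h₀` only.
  obtain ⟨L, hb⟩ := StepBounds.exists hG hB (R + 1)
  have hL := hb.nonneg
  refine ⟨4 * L, by positivity, fun δ hδ => ?_⟩
  obtain ⟨h₁, hh₁, H⟩ := OneStep.exists_restrict hG hB hR hδ one_pos
  refine ⟨min h₁ (min 1 (1 / 2 / (L + 1))), by positivity,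
    fun t h x x' y y' ht hx hx' h0 hh hy hy' => ?_⟩
  have hle := hh.trans (min_le_left _ _)
  have hh := hh.trans (min_le_right _ _)
  refine norm_step_sub_le hb zero_le_one h0.le ((hh.trans (min_le_left _ _)).trans hR) ?_ hx hx' ht
    (H t h x y ht hx h0 hle hy) (H t h x' y' ht hx' h0 hle hy')
  calc h * L ≤ 1 / 2 / (L + 1) * (L + 1) := by
        gcongr
        · exact hh.trans (min_le_right _ _)
        · linarith
    _ = 1 / 2 := by field_simp

/-- The results of the steps have Taylor expansions in the step size, uniformly on balls. -/
theorem OneStep.exists_taylor_bound {p : ℕ} (hG : ContDiff ℝ ((p + 1 : ℕ) : WithTop ℕ∞) G)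
    (hB : ContDiff ℝ ((p + 1 : ℕ) : WithTop ℕ∞) B) {R : ℝ} (hR : 1 ≤ R) :
    ∃ (C : ℝ) (a : E × ℝ → ℕ → E), ∀ δ : ℝ, 0 < δ → ∃ h₀ : ℝ, 0 < h₀ ∧ ∀ t h x y, |t| ≤ R →
      ‖x‖ ≤ R → 0 < h → h ≤ h₀ → OneStep G B δ t h x y →
      ‖y - ∑ k ∈ Finset.range (p + 1), h ^ k • a (x, t) k‖ ≤ C * h ^ (p + 1) := by
  have h1 : (1 : WithTop ℕ∞) ≤ ((p + 1 : ℕ) : WithTop ℕ∞) := by exact_mod_cast p.succ_pos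
  obtain ⟨L, hb⟩ := StepBounds.exists (hG.of_le h1) (hB.of_le h1) (R + 1)
  have hL := hb.nonneg
  have : ProperSpace (E × ℝ) := FiniteDimensional.proper ℝ _
  -- Replacing the implicit stages by the `p`-th Picard iterate gives an explicit `C^(p+1)` function
  -- of step size, start and time. The replacement costs `O(h^(p+2))`, one power of `h` more than
  -- needed.
  have hf : ContDiff ℝ ((p + 1 : ℕ) : WithTop ℕ∞)
      (fun w : ℝ × E × ℝ => w.2.1 + w.1 • B (picardStage G p w, w)) :=
    (contDiff_fst.comp contDiff_snd).add
      (contDiff_fst.smul (hB.comp ((contDiff_picardStage hG p).prodMk contDiff_id)))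
  obtain ⟨C, a, hC⟩ := exists_taylor_bound_of_isCompact hf (isCompact_closedBall (0 : E × ℝ) R)
  refine ⟨L ^ (p + 2) + C, a, fun δ hδ => ?_⟩
  obtain ⟨h₁, hh₁, H⟩ := OneStep.exists_restrict (hG.of_le h1) (hB.of_le h1) hR hδ one_pos
  refine ⟨min h₁ (min 1 (1 / (L + 1))), by positivity, fun t h x y ht hx h0 hh hy => ?_⟩
  obtain ⟨U, hU, rfl, hU1⟩ := H t h x y ht hx h0 (hh.trans (min_le_left _ _)) hy
  have hh := hh.trans (min_le_right _ _)
  have hh1 := hh.trans (min_le_left _ _)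
  have hhL : h * L ≤ 1 := by
    calc h * L ≤ 1 / (L + 1) * (L + 1) := by
          gcongr
          · exact hh.trans (min_le_right _ _)
          · linarith
      _ = 1 := by field_simp
  have hT := hC (x, t) (by simp [Prod.norm_def, hx, ht]) h h0 hh1
  have hP := norm_stage_sub_picardStage_le hb h0.le (hh1.trans hR) hhL hx ht hU1 hU p
  have habs : |h| ≤ R := by rw [abs_of_pos h0]; linarith
  have hBd : ‖B (U, h, x, t) - B (picardStage G p (h, x, t), h, x, t)‖ ≤ L * (h * L) ^ (p + 1) := by
    refine (hb.lipB _ _ (norm_stage_point_le zero_le_one hU1 habs hx ht)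
      (norm_stage_point_le zero_le_one (norm_picardStage_sub_le hb h0.le (hh1.trans hR) hhL hx ht p)
        habs hx ht)).trans ?_
    gcongr
    refine (norm_point_sub_le ..).trans ?_
    rwa [sub_self, norm_zero, add_zero]
  have e : x + h • B (U, h, x, t) - ∑ k ∈ Finset.range (p + 1), h ^ k • a (x, t) k =
      h • (B (U, h, x, t) - B (picardStage G p (h, x, t), h, x, t)) +
      (x + h • B (picardStage G p (h, x, t), h, x, t) -
        ∑ k ∈ Finset.range (p + 1), h ^ k • a (x, t) k) := by rw [smul_sub]; abel
  rw [e, add_mul]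
  refine (norm_add_le _ _).trans (add_le_add ?_ hT)
  rw [norm_smul, Real.norm_of_nonneg h0.le]
  calc _ ≤ 1 * (L * (h * L) ^ (p + 1)) := by gcongr
    _ = _ := by ring

/-- Pointwise consistency of order `p` along a `C^(p+1)` curve is uniform. -/
theorem OneStep.exists_local_error_bound {p : ℕ} (hG : ContDiff ℝ ((p + 1 : ℕ) : WithTop ℕ∞) G)
    (hB : ContDiff ℝ ((p + 1 : ℕ) : WithTop ℕ∞) B) {Tf R : ℝ} {u : ℝ → E} (hR : 1 ≤ R)
    (hu : ContDiffOn ℝ ((p + 1 : ℕ) : WithTop ℕ∞) u (Icc 0 Tf)) (hTR : Tf ≤ R)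
    (huR : ∀ t ∈ Icc 0 Tf, ‖u t‖ ≤ R)
    (hcons : ∀ t, 0 ≤ t → t < Tf → ∃ C δ h₀ : ℝ, 0 < δ ∧ 0 < h₀ ∧ ∀ h, 0 < h → h ≤ h₀ →
      ∀ y, OneStep G B δ t h (u t) y → ‖y - u (t + h)‖ ≤ C * h ^ (p + 1)) :
    ∃ C : ℝ, 0 ≤ C ∧ ∀ δ : ℝ, 0 < δ → ∃ h₀ : ℝ, 0 < h₀ ∧ ∀ t h y, 0 ≤ t → 0 < h → h ≤ h₀ →
      t + h ≤ Tf → OneStep G B δ t h (u t) y → ‖y - u (t + h)‖ ≤ C * h ^ (p + 1) := by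
  have h1 : (1 : WithTop ℕ∞) ≤ ((p + 1 : ℕ) : WithTop ℕ∞) := by exact_mod_cast p.succ_pos
  obtain ⟨C₁, a, ha⟩ := OneStep.exists_taylor_bound hG hB hR
  obtain ⟨C₂, b, hb⟩ := exists_taylor_bound_Icc hu
  -- Both Taylor polynomials have degree at most `p` and differ by `O(h^(p+1))`, with a constant
  -- that may depend on `t`; hence they are equal. Solvability matters here: without a result `y`
  -- for each small `h`, consistency would be vacuous.
  have hab : ∀ t, 0 ≤ t → t < Tf → ∀ k < p + 1, a (u t, t) k = b t k := by
    intro t ht htT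
    have htR : |t| ≤ R := by rw [abs_of_nonneg ht]; linarith
    have hut := huR t ⟨ht, htT.le⟩
    obtain ⟨C₃, δ, h₃, hδ, hh₃, H₃⟩ := hcons t ht htT
    obtain ⟨h₁, hh₁, H₁⟩ := ha δ hδ
    obtain ⟨h₂, hh₂, H₂⟩ := OneStep.existsUnique (hG.of_le h1) (hB.of_le h1) hR hδ
    have hTt : 0 < Tf - t := by linarith
    intro k hk
    refine sub_eq_zero.1 (eq_zero_of_norm_sum_pow_smul_le (a := fun k => a (u t, t) k - b t k)
      (h₀ := min (min h₁ h₂) (min h₃ (Tf - t))) (C := C₁ + C₃ + C₂) (by positivity) ?_ k hk)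
    intro h h0 hh
    simp only [le_min_iff] at hh
    obtain ⟨⟨hle₁, hle₂⟩, hle₃, hle₄⟩ := hh
    obtain ⟨y, hy, -⟩ := H₂ t h (u t) htR hut h0 hle₂
    have e₁ := H₁ t h (u t) y htR hut h0 hle₁ hy
    have e₂ := hb t h ht h0 (by linarith)
    have e₃ := H₃ h h0 hle₃ y hy
    have e : ∑ k ∈ Finset.range (p + 1), h ^ k • (a (u t, t) k - b t k) =
        -(y - ∑ k ∈ Finset.range (p + 1), h ^ k • a (u t, t) k) + (y - u (t + h)) +
        (u (t + h) - ∑ k ∈ Finset.range (p + 1), h ^ k • b t k) := by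
      simp only [smul_sub, Finset.sum_sub_distrib]; abel
    rw [e]
    refine (norm_add₃_le).trans ?_
    rw [norm_neg]
    linarith
  -- The pointwise constant has served its purpose; only the two uniform remainder constants enter.
  refine ⟨max C₁ 0 + max C₂ 0, by positivity, fun δ hδ => ?_⟩
  obtain ⟨h₁, hh₁, H₁⟩ := ha δ hδ
  refine ⟨h₁, hh₁, fun t h y ht h0 hh hth hy => ?_⟩
  have htT : t < Tf := by linarith
  have e₁ := H₁ t h (u t) y (by rw [abs_of_nonneg ht]; linarith) (huR t ⟨ht, htT.le⟩) h0 hh hy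
  have e₂ := hb t h ht h0 hth
  rw [Finset.sum_congr rfl fun k hk => by rw [hab t ht htT k (Finset.mem_range.1 hk)]] at e₁
  have e : y - u (t + h) = (y - ∑ k ∈ Finset.range (p + 1), h ^ k • b t k) -
      (u (t + h) - ∑ k ∈ Finset.range (p + 1), h ^ k • b t k) := by abel
  rw [e]
  refine (norm_sub_le _ _).trans ?_
  have hpow : 0 ≤ h ^ (p + 1) := by positivity
  nlinarith [mul_le_mul_of_nonneg_right (le_max_left C₁ 0) hpow,
    mul_le_mul_of_nonneg_right (le_max_left C₂ 0) hpow]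

end

/-! ### Error propagation on a time grid -/

/-- Convergence of a consistent and stable one-step method `Φ t h x y` (the step of size `h` from
`x` at time `t` leads to `y`), with unique solvability in a tube around the solution. -/
theorem existsUnique_run_and_error_le {E : Type*} [NormedAddCommGroup E]
    {Φ : ℝ → ℝ → E → E → Prop} {u : ℝ → E} {Tf C L h₀ : ℝ} {p : ℕ} (hC : 0 ≤ C) (hL : 0 ≤ L)
    (hex : ∀ t h x, 0 ≤ t → 0 < h → h ≤ h₀ → t + h ≤ Tf → ‖x - u t‖ ≤ 1 → ∃! y, Φ t h x y)
    (hstab : ∀ t h x y y', 0 ≤ t → 0 < h → h ≤ h₀ → t + h ≤ Tf → ‖x - u t‖ ≤ 1 → Φ t h x y →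
      Φ t h (u t) y' → ‖y - y'‖ ≤ (1 + L * h) * ‖x - u t‖)
    (hloc : ∀ t h y, 0 ≤ t → 0 < h → h ≤ h₀ → t + h ≤ Tf → Φ t h (u t) y →
      ‖y - u (t + h)‖ ≤ C * h ^ (p + 1))
    (hsmall : ∀ Δt, 0 ≤ Δt → Δt ≤ h₀ → C * Tf * Real.exp (L * Tf) * Δt ^ p ≤ 1)
    {N : ℕ} {tg : Fin (N + 1) → ℝ} {Δt : ℝ} (hΔ : 0 ≤ Δt) (h0 : tg 0 = 0)
    (hT : tg (Fin.last N) = Tf)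
    (hgrid : ∀ n : Fin N, tg n.castSucc < tg n.succ ∧ tg n.succ - tg n.castSucc ≤ Δt)
    (hΔ₀ : Δt ≤ h₀) :
    (∃! v : Fin (N + 1) → E, v 0 = u 0 ∧ ∀ n : Fin N,
      Φ (tg n.castSucc) (tg n.succ - tg n.castSucc) (v n.castSucc) (v n.succ)) ∧
    ∀ v : Fin (N + 1) → E, (v 0 = u 0 ∧ ∀ n : Fin N,
      Φ (tg n.castSucc) (tg n.succ - tg n.castSucc) (v n.castSucc) (v n.succ)) →
      ∀ n, ‖v n - u (tg n)‖ ≤ C * Tf * Real.exp (L * Tf) * Δt ^ p := by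
  have hmono : StrictMono tg := Fin.strictMono_iff_lt_succ.2 fun n => (hgrid n).1
  have hpos : ∀ n, 0 ≤ tg n := fun n => h0 ▸ hmono.monotone (Fin.zero_le n)
  have hle : ∀ n, tg n ≤ Tf := fun n => hT ▸ hmono.monotone (Fin.le_last n)
  -- This bound is propagated by each step, as shown in `hstepE`, and it stays below 1, so the
  -- numerical solution never leaves the tube.
  let e : Fin (N + 1) → ℝ := fun n => C * tg n * Real.exp (L * tg n) * Δt ^ p
  have heT : ∀ n, e n ≤ C * Tf * Real.exp (L * Tf) * Δt ^ p := by
    intro n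
    have h1 := hpos n
    have h2 := hle n
    have h3 : 0 ≤ Tf := h1.trans h2
    simp only [e]
    gcongr
  have he1 : ∀ n, e n ≤ 1 := fun n => (heT n).trans (hsmall Δt hΔ hΔ₀)
  have hstepE : ∀ (n : Fin N) (x y : E), ‖x - u (tg n.castSucc)‖ ≤ e n.castSucc →
      Φ (tg n.castSucc) (tg n.succ - tg n.castSucc) x y → ‖y - u (tg n.succ)‖ ≤ e n.succ := by
    intro n x y hx hy
    obtain ⟨hn1, hn2⟩ := hgrid n
    have ht0 := hpos n.castSucc
    have htT := hle n.succ
    obtain ⟨t, htdef⟩ : ∃ t, t = tg n.castSucc := ⟨_, rfl⟩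
    obtain ⟨h, hdef⟩ : ∃ h, h = tg n.succ - tg n.castSucc := ⟨_, rfl⟩
    have hs : tg n.succ = t + h := by linarith
    have he : e n.castSucc ≤ 1 := he1 _
    simp only [e] at hx he ⊢
    rw [← hdef] at hy hn2
    rw [hs] at htT ⊢
    rw [← htdef] at hx hy ht0 he
    have hh : 0 < h := by linarith
    have hh0 : h ≤ h₀ := hn2.trans hΔ₀
    obtain ⟨y', hy', -⟩ := hex t h (u t) ht0 hh hh0 htT (by simp)
    have b1 := hstab t h x y y' ht0 hh hh0 htT (hx.trans he) hy hy'
    have b2 := hloc t h y' ht0 hh hh0 htT hy'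
    have b3 : 1 + L * h ≤ Real.exp (L * h) := by linarith [Real.add_one_le_exp (L * h)]
    have b4 : 1 ≤ Real.exp (L * (t + h)) := Real.one_le_exp (by positivity)
    -- Compare with the step `y'` from the exact value: the inherited error grows by at most `exp (L
    -- * h)`, and the new local error is at most `C * h * Δt ^ p`.
    calc ‖y - u (t + h)‖ ≤ ‖y - y'‖ + ‖y' - u (t + h)‖ := norm_sub_le_norm_sub_add_norm_sub ..
      _ ≤ Real.exp (L * h) * (C * t * Real.exp (L * t) * Δt ^ p) + C * (h * Δt ^ p) := by
        refine add_le_add (b1.trans (by gcongr)) (b2.trans ?_)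
        rw [pow_succ']
        gcongr
      _ = C * t * Real.exp (L * (t + h)) * Δt ^ p + 1 * (C * h * Δt ^ p) := by
        rw [mul_add, Real.exp_add]; ring
      _ ≤ C * t * Real.exp (L * (t + h)) * Δt ^ p +
          Real.exp (L * (t + h)) * (C * h * Δt ^ p) := by gcongr
      _ = _ := by ring
  have herr : ∀ v : Fin (N + 1) → E, (v 0 = u 0 ∧ ∀ n : Fin N,
      Φ (tg n.castSucc) (tg n.succ - tg n.castSucc) (v n.castSucc) (v n.succ)) →
      ∀ n, ‖v n - u (tg n)‖ ≤ e n := by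
    rintro v ⟨hv0, hv⟩ n
    induction n using Fin.induction with
    | zero => simp [hv0, h0, e]
    | succ n ih => exact hstepE n _ _ ih (hv n)
  have hexg : ∀ (n : Fin N) (x : E), ‖x - u (tg n.castSucc)‖ ≤ e n.castSucc →
      ∃! y, Φ (tg n.castSucc) (tg n.succ - tg n.castSucc) x y := fun n x hx =>
    hex _ _ _ (hpos _) (sub_pos.2 (hgrid n).1) ((hgrid n).2.trans hΔ₀)
      (by rw [add_sub_cancel]; exact hle _) (hx.trans (he1 _))
  refine ⟨?_, fun v hv n => (herr v hv n).trans (heT n)⟩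
  refine existsUnique_of_exists_of_unique ?_ ?_
  -- The step map is made total by an arbitrary value outside the tube, so that it can be iterated;
  -- the error bound shows that this value never occurs.
  · have : ∀ (n : Fin N) (x : E), ∃ y, ‖x - u (tg n.castSucc)‖ ≤ e n.castSucc →
        Φ (tg n.castSucc) (tg n.succ - tg n.castSucc) x y := fun n x => by
      by_cases hx : ‖x - u (tg n.castSucc)‖ ≤ e n.castSucc
      · obtain ⟨y, hy, -⟩ := hexg n x hx
        exact ⟨y, fun _ => hy⟩
      · exact ⟨x, fun h => absurd h hx⟩
    choose F hF using this
    let v : Fin (N + 1) → E := fun n => Fin.induction (motive := fun _ => E) (u 0) F n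
    have hv0 : v 0 = u 0 := rfl
    have hvs : ∀ n : Fin N, v n.succ = F n (v n.castSucc) := fun n => by
      simp only [v, Fin.induction_succ]
    have hve : ∀ n, ‖v n - u (tg n)‖ ≤ e n := by
      intro n
      induction n using Fin.induction with
      | zero => simp [hv0, h0, e]
      | succ n ih => exact hstepE n _ _ ih (hvs n ▸ hF n _ ih)
    exact ⟨v, hv0, fun n => hvs n ▸ hF n _ (hve _)⟩
  · intro v w hv hw
    funext n
    induction n using Fin.induction with
    | zero => rw [hv.1, hw.1]
    | succ n ih =>
      exact (hexg n _ (herr v hv _)).unique (hv.2 n) (ih ▸ hw.2 n)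

/-! ### IMEX-RK schemes as one-step methods -/

/-- Right-hand side of the stage equations of an IMEX-RK scheme, as a function of the stages, the
step size, the starting value (on which the splitting may depend) and the time. -/
noncomputable def imexStages {s : ℕ} (T : IMEXTableau s) {E : Type} [NormedAddCommGroup E]
    [NormedSpace ℝ E] (M : E ≃L[ℝ] E) (f g : E → E → ℝ → E)
    (z : (Fin s → E) × ℝ × E × ℝ) (j : Fin s) : E :=
  ∑ q ∈ Finset.Iio j, T.Ahat j q • M.symm (f z.2.2.1 (z.1 q) (z.2.2.2 + T.chat q * z.2.1)) +
    ∑ q ∈ Finset.Iic j, T.A j q • M.symm (g z.2.2.1 (z.1 q) (z.2.2.2 + T.c q * z.2.1))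

/-- Increment function of an IMEX-RK scheme. -/
noncomputable def imexUpdate {s : ℕ} (T : IMEXTableau s) {E : Type} [NormedAddCommGroup E]
    [NormedSpace ℝ E] (M : E ≃L[ℝ] E) (f g : E → E → ℝ → E)
    (z : (Fin s → E) × ℝ × E × ℝ) : E :=
  ∑ q, T.bhat q • M.symm (f z.2.2.1 (z.1 q) (z.2.2.2 + T.chat q * z.2.1)) +
    ∑ q, T.b q • M.symm (g z.2.2.1 (z.1 q) (z.2.2.2 + T.c q * z.2.1))

section

variable {s : ℕ} {T : IMEXTableau s} {E : Type} [NormedAddCommGroup E] [NormedSpace ℝ E]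
  {M : E ≃L[ℝ] E} {f g : E → E → ℝ → E}

theorem contDiff_stage_velocity {n : WithTop ℕ∞}
    (hf : ContDiff ℝ n (fun w : E × E × ℝ => f w.1 w.2.1 w.2.2)) (q : Fin s) (a : ℝ) :
    ContDiff ℝ n (fun z : (Fin s → E) × ℝ × E × ℝ =>
      M.symm (f z.2.2.1 (z.1 q) (z.2.2.2 + a * z.2.1))) := by
  have h : ContDiff ℝ n (fun z : (Fin s → E) × ℝ × E × ℝ =>
      ((z.2.2.1, z.1 q, z.2.2.2 + a * z.2.1) : E × E × ℝ)) := by fun_prop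
  exact M.symm.contDiff.comp (hf.comp h)

theorem contDiff_imexStages {n : WithTop ℕ∞}
    (hf : ContDiff ℝ n (fun w : E × E × ℝ => f w.1 w.2.1 w.2.2))
    (hg : ContDiff ℝ n (fun w : E × E × ℝ => g w.1 w.2.1 w.2.2)) :
    ContDiff ℝ n (imexStages T M f g) :=
  contDiff_pi.2 fun _ =>
    (ContDiff.sum fun q _ => contDiff_const.smul (contDiff_stage_velocity hf q _)).add
      (ContDiff.sum fun q _ => contDiff_const.smul (contDiff_stage_velocity hg q _))

theorem contDiff_imexUpdate {n : WithTop ℕ∞}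
    (hf : ContDiff ℝ n (fun w : E × E × ℝ => f w.1 w.2.1 w.2.2))
    (hg : ContDiff ℝ n (fun w : E × E × ℝ => g w.1 w.2.1 w.2.2)) :
    ContDiff ℝ n (imexUpdate T M f g) :=
  (ContDiff.sum fun q _ => contDiff_const.smul (contDiff_stage_velocity hf q _)).add
    (ContDiff.sum fun q _ => contDiff_const.smul (contDiff_stage_velocity hg q _))

/-- Elimination of the velocity stages. -/
theorem exists_imexStep_iff {δ t h : ℝ} (hδ : 0 ≤ δ) {x y : E} :
    (∃ U Ke Ki : Fin s → E, IMEXStep T M (f x) (g x) t h x U Ke Ki y ∧ ∀ j, ‖U j - x‖ ≤ δ) ↔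
      OneStep (imexStages T M f g) (imexUpdate T M f g) δ t h x y := by
  have hn : ∀ U : Fin s → E, ‖U - fun _ => x‖ ≤ δ ↔ ∀ j, ‖U j - x‖ ≤ δ := fun U => by
    rw [pi_norm_le_iff_of_nonneg hδ]; rfl
  constructor
  · rintro ⟨U, Ke, Ki, hstep, hU⟩
    have hKe : ∀ j, Ke j = h • M.symm (f x (U j) (t + T.chat j * h)) := fun j => by
      rw [← map_smul, ← hstep.expl j, M.symm_apply_apply]
    have hKi : ∀ j, Ki j = h • M.symm (g x (U j) (t + T.c j * h)) := fun j => by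
      rw [← map_smul, ← hstep.impl j, M.symm_apply_apply]
    refine ⟨U, ?_, ?_, (hn U).2 hU⟩
    · funext j
      rw [hstep.stage j]
      simp only [hKe, hKi, Pi.add_apply, Pi.smul_apply, imexStages, smul_add, Finset.smul_sum,
        smul_comm h, add_assoc]
    · rw [hstep.update]
      simp only [hKe, hKi, imexUpdate, smul_add, Finset.smul_sum, smul_comm h, add_assoc]
  · rintro ⟨U, hU, hy, hUδ⟩
    refine ⟨U, fun j => h • M.symm (f x (U j) (t + T.chat j * h)),
      fun j => h • M.symm (g x (U j) (t + T.c j * h)), ⟨?_, ?_, ?_, ?_⟩, (hn U).1 hUδ⟩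
    · rw [hy]
      simp only [imexUpdate, smul_add, Finset.smul_sum, smul_comm h, add_assoc]
    · intro j; simp
    · intro j; simp
    · intro j
      conv_lhs => rw [hU]
      simp only [Pi.add_apply, Pi.smul_apply, imexStages, smul_add, Finset.smul_sum, smul_comm h,
        add_assoc]

/-- Explicit stages may be evaluated at the implicit abscissae if these satisfy the row-sum
condition: time is added to the system as a component that is treated implicitly. -/
theorem IMEXTableau.HasOrder.withExplicitTimes_c {p : ℕ} (hT : T.HasOrder p)
    (hc : ∀ j, T.c j = ∑ k ∈ Finset.Iic j, T.A j k) : (T.withExplicitTimes T.c).HasOrder p := by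
  intro E _ _ _ M f g hf hg u t₀ ε hε hu
  -- The augmented system is autonomous, with the velocity 1 of time put into the implicit part. By
  -- the row-sum condition the time component of stage `j` is `t₀ + T.c j * h`, and both parts see
  -- this time.
  obtain ⟨C, δ, h₀, hδ, hh₀, H⟩ := hT (E × ℝ)
    (M.prodCongr (ContinuousLinearEquiv.refl ℝ ℝ)) (fun v _ => (f v.1 v.2, 0))
    (fun v _ => (g v.1 v.2, 1)) ((hf.comp contDiff_fst).prodMk contDiff_const)
    ((hg.comp contDiff_fst).prodMk contDiff_const) (fun t => (u t, t)) t₀ ε hε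
    (fun t ht => by
      obtain ⟨v, hv, hv'⟩ := hu t ht
      exact ⟨(v, 1), hv.prodMk (hasDerivWithinAt_id t _), by simp [hv']⟩)
  obtain ⟨K, hK⟩ : ∃ K : ℝ, ∀ j, |T.c j| ≤ K := by
    refine ⟨∑ j, |T.c j|, fun j => Finset.single_le_sum (f := fun j => |T.c j|)
      (fun _ _ => abs_nonneg _) (Finset.mem_univ j)⟩
  have hK1 : 0 < |K| + 1 := by positivity
  refine ⟨C, δ, min h₀ (δ / (|K| + 1)), hδ, by positivity, fun h h0 hh U Ke Ki y hs hU => ?_⟩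
  -- The time component of the result is left as `t₀ + ∑ q, T.b q * h`: only the first component of
  -- the error is used, so `∑ q, T.b q = 1` is not needed.
  have key := H h h0 (hh.trans (min_le_left _ _)) (fun j => (U j, t₀ + T.c j * h))
    (fun j => (Ke j, 0)) (fun j => (Ki j, h)) (y, t₀ + ∑ q, T.b q * h)
    ⟨?_, ?_, ?_, ?_⟩ ?_
  · exact (norm_fst_le _).trans key
  · have := hs.update
    ext
    · simpa [IMEXTableau.withExplicitTimes, Prod.fst_sum] using this
    · simp [Prod.snd_sum]
  · intro j
    have := hs.impl j
    ext
    · simpa [IMEXTableau.withExplicitTimes] using this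
    · simp
  · intro j
    have := hs.expl j
    ext
    · simpa [IMEXTableau.withExplicitTimes] using this
    · simp
  · intro j
    have := hs.stage j
    ext
    · simpa [IMEXTableau.withExplicitTimes, Prod.fst_sum] using this
    · simp [Prod.snd_sum, hc j, Finset.sum_mul]
  · intro j
    refine max_le (hU j) ?_
    have : ‖T.c j * h‖ ≤ δ := by
      rw [norm_mul, Real.norm_eq_abs, Real.norm_of_nonneg h0.le]
      calc |T.c j| * h ≤ (|K| + 1) * (δ / (|K| + 1)) := by
            gcongr
            · linarith [hK j, le_abs_self K]
            · exact hh.trans (min_le_right _ _)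
        _ = δ := by field_simp
    simpa using this

/-- Convergence of an IMEX-RK scheme of order `p` whose splitting depends on the starting value of
the step. -/
theorem IMEXTableau.HasOrder.convergence [FiniteDimensional ℝ E] {p : ℕ} (hp : 1 ≤ p)
    (hT : T.HasOrder p)
    (hf : ContDiff ℝ ((p + 1 : ℕ) : WithTop ℕ∞) (fun w : E × E × ℝ => f w.1 w.2.1 w.2.2))
    (hg : ContDiff ℝ ((p + 1 : ℕ) : WithTop ℕ∞) (fun w : E × E × ℝ => g w.1 w.2.1 w.2.2))
    {F : E → ℝ → E} (hF : ∀ x v t, F v t = f x v t + g x v t) {Tf : ℝ} (hTf : 0 < Tf) {u : ℝ → E}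
    (hu : SolvesODE M F u (Icc 0 Tf)) {Φ : ℝ → ℝ → ℝ → E → E → Prop}
    (hΦ : ∀ δ t h x y, Φ δ t h x y ↔ ∃ U Ke Ki : Fin s → E,
      IMEXStep T M (f x) (g x) t h x U Ke Ki y ∧ ∀ j, ‖U j - x‖ ≤ δ) :
    ∃ C : ℝ, ∀ δ : ℝ, 0 < δ → ∃ h₀ : ℝ, 0 < h₀ ∧
      (∀ t h : ℝ, 0 ≤ t → 0 < h → h ≤ h₀ → t + h ≤ Tf →
        (∃! y, Φ δ t h (u t) y) ∧ ∀ y, Φ δ t h (u t) y → ‖y - u (t + h)‖ ≤ C * h ^ (p + 1)) ∧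
      (∀ (N : ℕ) (tg : Fin (N + 1) → ℝ) (Δt : ℝ), tg 0 = 0 → tg (Fin.last N) = Tf →
        (∀ n : Fin N, tg n.castSucc < tg n.succ ∧ tg n.succ - tg n.castSucc ≤ Δt) → Δt ≤ h₀ →
        (∃! v : Fin (N + 1) → E, v 0 = u 0 ∧ ∀ n : Fin N,
          Φ δ (tg n.castSucc) (tg n.succ - tg n.castSucc) (v n.castSucc) (v n.succ)) ∧
        ∀ v : Fin (N + 1) → E, (v 0 = u 0 ∧ ∀ n : Fin N,
          Φ δ (tg n.castSucc) (tg n.succ - tg n.castSucc) (v n.castSucc) (v n.succ)) →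
          ∀ n, ‖v n - u (tg n)‖ ≤ C * Δt ^ p) := by
  set G := imexStages T M f g
  set B := imexUpdate T M f g
  have h1 : (1 : WithTop ℕ∞) ≤ ((p + 1 : ℕ) : WithTop ℕ∞) := by exact_mod_cast p.succ_pos
  have hG : ContDiff ℝ ((p + 1 : ℕ) : WithTop ℕ∞) G := contDiff_imexStages hf hg
  have hB : ContDiff ℝ ((p + 1 : ℕ) : WithTop ℕ∞) B := contDiff_imexUpdate hf hg
  have hfx : ∀ x, ContDiff ℝ ((p + 1 : ℕ) : WithTop ℕ∞) (fun z : E × ℝ => f x z.1 z.2) :=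
    fun x => hf.comp (contDiff_const.prodMk contDiff_id)
  have hgx : ∀ x, ContDiff ℝ ((p + 1 : ℕ) : WithTop ℕ∞) (fun z : E × ℝ => g x z.1 z.2) :=
    fun x => hg.comp (contDiff_const.prodMk contDiff_id)
  have hFs : ContDiff ℝ ((p + 1 : ℕ) : WithTop ℕ∞) (fun z : E × ℝ => F z.1 z.2) := by
    simp only [hF 0]
    exact (hfx 0).add (hgx 0)
  have huc := hu.contDiffOn hTf hFs
  obtain ⟨R₀, hR₀⟩ := isCompact_Icc.exists_bound_of_continuousOn huc.continuousOn
  -- The ball of radius `R` holds the tube of radius 1 around the solution, and `R` also bounds all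
  -- times.
  obtain ⟨R, hRdef⟩ : ∃ R, R = |R₀| + Tf + 1 := ⟨_, rfl⟩
  have hR1 : 1 ≤ R := by linarith [abs_nonneg R₀]
  have hTR : Tf ≤ R := by linarith [abs_nonneg R₀]
  have huR' : ∀ t ∈ Icc 0 Tf, ‖u t‖ + 1 ≤ R := fun t ht => by
    linarith [hR₀ t ht, le_abs_self R₀]
  have huR : ∀ t ∈ Icc 0 Tf, ‖u t‖ ≤ R := fun t ht => by linarith [huR' t ht]
  -- The splitting is frozen at `u t`. Its sum is still `F`, so `u` restricted to `[t, Tf]` solves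
  -- the frozen system.
  have hcons : ∀ t, 0 ≤ t → t < Tf → ∃ C δ h₀ : ℝ, 0 < δ ∧ 0 < h₀ ∧ ∀ h, 0 < h → h ≤ h₀ →
      ∀ y, OneStep G B δ t h (u t) y → ‖y - u (t + h)‖ ≤ C * h ^ (p + 1) := by
    intro t ht htT
    have hsub : Icc t (t + (Tf - t)) ⊆ Icc 0 Tf := by
      rw [add_sub_cancel]; exact Icc_subset_Icc_left ht
    obtain ⟨C, δ, h₀, hδ, hh₀, H⟩ := hT E M (f (u t)) (g (u t)) (hfx _) (hgx _) u t (Tf - t)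
      (by linarith) (fun r hr => by
        obtain ⟨v, hv, hv'⟩ := hu r (hsub hr)
        exact ⟨v, hv.mono hsub, by rw [hv', hF (u t)]⟩)
    refine ⟨C, δ, h₀, hδ, hh₀, fun h h0 hh y hy => ?_⟩
    obtain ⟨U, Ke, Ki, hs, hU⟩ := (exists_imexStep_iff hδ.le).2 hy
    exact H h h0 hh U Ke Ki y hs hU
  obtain ⟨C, hC, Hloc⟩ := OneStep.exists_local_error_bound hG hB hR1 huc hTR huR hcons
  obtain ⟨L, hL, Hstab⟩ := OneStep.exists_lipschitz (hG.of_le h1) (hB.of_le h1) hR1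
  obtain ⟨D, hD⟩ : ∃ D, D = C * Tf * Real.exp (L * Tf) := ⟨_, rfl⟩
  have hD0 : 0 ≤ D := by rw [hD]; positivity
  refine ⟨C + D, fun δ hδ => ?_⟩
  have hΦ' : ∀ t h x y, Φ δ t h x y ↔ OneStep G B δ t h x y := fun t h x y =>
    (hΦ δ t h x y).trans (exists_imexStep_iff hδ.le)
  obtain ⟨h₁, hh₁, H₁⟩ := Hloc δ hδ
  obtain ⟨h₂, hh₂, H₂⟩ := Hstab δ hδ
  obtain ⟨h₃, hh₃, H₃⟩ := OneStep.existsUnique (hG.of_le h1) (hB.of_le h1) hR1 hδ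
  have hmem : ∀ t h : ℝ, 0 ≤ t → 0 < h → t + h ≤ Tf → t ∈ Icc 0 Tf ∧ |t| ≤ R := fun t h ht h0 hth =>
    ⟨⟨ht, by linarith⟩, by rw [abs_of_nonneg ht]; linarith⟩
  have htube : ∀ t ∈ Icc 0 Tf, ∀ x, ‖x - u t‖ ≤ 1 → ‖x‖ ≤ R := fun t ht x hx => by
    linarith [huR' t ht, norm_le_norm_sub_add x (u t)]
  -- The last two entries give `D * h ^ p ≤ 1`, by `p ≥ 1`; this is the tube condition.
  obtain ⟨h₀, hh₀⟩ : ∃ h₀, h₀ = min (min h₁ h₂) (min h₃ (min 1 (1 / (D + 1)))) := ⟨_, rfl⟩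
  have hpos : 0 < h₀ := by rw [hh₀]; positivity
  have hle : ∀ h ≤ h₀, (h ≤ h₁ ∧ h ≤ h₂) ∧ h ≤ h₃ ∧ h ≤ 1 ∧ h ≤ 1 / (D + 1) := fun h hh => by
    simpa only [hh₀, le_min_iff] using hh
  refine ⟨h₀, hpos, ?_, ?_⟩
  · intro t h ht h0 hh hth
    obtain ⟨hm, htR⟩ := hmem t h ht h0 hth
    simp only [hΦ']
    refine ⟨H₃ t h (u t) htR (huR t hm) h0 (hle h hh).2.1, fun y hy => ?_⟩
    refine (H₁ t h y ht h0 (hle h hh).1.1 hth hy).trans ?_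
    gcongr
    linarith
  · intro N tg Δt htg0 htgT hgrid hΔ
    have hΔ0 : 0 ≤ Δt := by
      cases N with
      | zero => rw [show Fin.last 0 = 0 from rfl, htg0] at htgT; linarith
      | succ N => linarith [(hgrid 0).1, (hgrid 0).2]
    have main := existsUnique_run_and_error_le (Φ := Φ δ) (u := u) (p := p) (h₀ := h₀) (Tf := Tf)
      hC hL
      (fun t h x ht h0 hh hth hx => by
        obtain ⟨hm, htR⟩ := hmem t h ht h0 hth
        simp only [hΦ']
        exact H₃ t h x htR (htube t hm x hx) h0 (hle h hh).2.1)
      (fun t h x y y' ht h0 hh hth hx hy hy' => by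
        obtain ⟨hm, htR⟩ := hmem t h ht h0 hth
        exact H₂ t h x (u t) y y' htR (htube t hm x hx) (huR t hm) h0 (hle h hh).1.2
          ((hΦ' ..).1 hy) ((hΦ' ..).1 hy'))
      (fun t h y ht h0 hh hth hy => H₁ t h y ht h0 (hle h hh).1.1 hth ((hΦ' ..).1 hy))
      (fun k hk0 hk => by
        rw [← hD]
        have hk1 := (hle k hk).2.2
        calc D * k ^ p ≤ (D + 1) * (1 / (D + 1)) := by
              gcongr
              · linarith
              · exact (pow_le_of_le_one hk0 hk1.1 (by omega)).trans hk1.2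
          _ = 1 := by field_simp)
      hΔ0 htg0 htgT hgrid hΔ
    refine ⟨main.1, fun v hv n => (main.2 v hv n).trans ?_⟩
    rw [← hD]
    gcongr
    linarith

end

/-! ### The partitioned scheme as an IMEX-RK scheme -/

namespace MultiphysicsSystem

variable {m : ℕ} {V W : Fin m → Type}
  [∀ i, NormedAddCommGroup (V i)] [∀ i, NormedSpace ℝ (V i)]

/-- Inserting the unknown `u i` into the available data turns "no `k`" into `k = i` and `k < i` into
`k ≤ i`, which is the passage from weak to strong predictors. -/
theorem predictor_eq_cpl_couplingState (S : MultiphysicsSystem V W) (P : CouplingPredictor)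
    (u ubar : ∀ i, V i) (t : ℝ) (i : Fin m) :
    S.predictor P u ubar t i = S.cpl i (couplingState P i u ubar) t := by
  cases P
  · rfl
  · simp only [predictor, couplingState, available]
    congr 1
    funext k
    by_cases h : k = i
    · subst h; simp
    · simp [h]
  · rfl
  · simp only [predictor, couplingState, available]
    congr 1
    funext k
    by_cases h : k = i
    · subst h; simp
    · simp [h, le_iff_lt_or_eq]

theorem partitionedStep_iff_imexStep (S : MultiphysicsSystem V W) (P : CouplingPredictor) {s : ℕ}
    (T : IMEXTableau s) (t h : ℝ) (x : ∀ i, V i) (U Ke Ki : Fin s → ∀ i, V i) (y : ∀ i, V i) :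
    S.PartitionedStep T P t h x U Ke Ki y ↔
      IMEXStep T S.monoMass (S.explVel P x) (S.implVel P x) t h x U Ke Ki y := by
  constructor
  · rintro ⟨h1, h2, h3, h4⟩
    refine ⟨?_, fun j => ?_, fun j => ?_, fun j => ?_⟩ <;> funext i
    · simpa [Finset.sum_apply] using h4 i
    · simpa [monoMass, implVel, monoVel, predictor_eq_cpl_couplingState] using h2 j i
    · simpa [monoMass, explVel, monoVel, monoCpl, predictor_eq_cpl_couplingState] using h3 j i
    · simpa [Finset.sum_apply] using h1 j i
  · rintro ⟨h1, h2, h3, h4⟩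
    refine ⟨fun j i => ?_, fun j i => ?_, fun j i => ?_, fun i => ?_⟩
    · simpa [Finset.sum_apply] using congrFun (h4 j) i
    · simpa [monoMass, implVel, monoVel, predictor_eq_cpl_couplingState] using congrFun (h2 j) i
    · simpa [monoMass, explVel, monoVel, monoCpl, predictor_eq_cpl_couplingState] using
        congrFun (h3 j) i
    · simpa [Finset.sum_apply] using congrFun h1 i

/-- Each component is a coordinate of one of the two arguments, selected by `P`, `i` and `k` alone.
-/
theorem contDiff_couplingState {n : WithTop ℕ∞} (P : CouplingPredictor) (i : Fin m) :
    ContDiff ℝ n (fun w : (∀ k, V k) × (∀ k, V k) => couplingState P i w.1 w.2) := by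
  refine contDiff_pi.2 fun k => ?_
  have h1 : ContDiff ℝ n (fun w : (∀ k, V k) × (∀ k, V k) => w.1 k) :=
    contDiff_pi.1 contDiff_fst k
  have h2 : ContDiff ℝ n (fun w : (∀ k, V k) × (∀ k, V k) => w.2 k) :=
    contDiff_pi.1 contDiff_snd k
  by_cases hk : k = i
  · subst hk
    cases P <;> simpa [couplingState, available]
  · by_cases hlt : k < i <;> cases P <;> simpa [couplingState, available, hk, hlt]

variable [∀ i, NormedAddCommGroup (W i)] [∀ i, NormedSpace ℝ (W i)]

theorem contDiff_implVel {n : WithTop ℕ∞} (S : MultiphysicsSystem V W) (P : CouplingPredictor)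
    (hr : ∀ i, ContDiff ℝ n (fun z : V i × W i × ℝ => S.vel i z.1 z.2.1 z.2.2))
    (hc : ∀ i, ContDiff ℝ n (fun z : (∀ k, V k) × ℝ => S.cpl i z.1 z.2)) :
    ContDiff ℝ n (fun w : (∀ k, V k) × (∀ k, V k) × ℝ => S.implVel P w.1 w.2.1 w.2.2) := by
  refine contDiff_pi.2 fun i => ?_
  simp only [implVel, monoVel, predictor_eq_cpl_couplingState]
  have h1 : ContDiff ℝ n (fun w : (∀ k, V k) × (∀ k, V k) × ℝ => (w.2.1, w.1)) := by fun_prop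
  have h2 : ContDiff ℝ n (fun w : (∀ k, V k) × (∀ k, V k) × ℝ => w.2.1 i) :=
    contDiff_pi.1 (contDiff_fst.comp contDiff_snd) i
  have h3 : ContDiff ℝ n (fun w : (∀ k, V k) × (∀ k, V k) × ℝ => w.2.2) := by fun_prop
  exact (hr i).comp (h2.prodMk
    (((hc i).comp (((contDiff_couplingState P i).comp h1).prodMk h3)).prodMk h3))

theorem contDiff_fullVel {n : WithTop ℕ∞} (S : MultiphysicsSystem V W)
    (hr : ∀ i, ContDiff ℝ n (fun z : V i × W i × ℝ => S.vel i z.1 z.2.1 z.2.2))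
    (hc : ∀ i, ContDiff ℝ n (fun z : (∀ k, V k) × ℝ => S.cpl i z.1 z.2)) :
    ContDiff ℝ n (fun w : (∀ k, V k) × ℝ => S.fullVel w.1 w.2) := by
  refine contDiff_pi.2 fun i => ?_
  have h2 : ContDiff ℝ n (fun w : (∀ k, V k) × ℝ => w.1 i) :=
    contDiff_pi.1 contDiff_fst i
  exact (hr i).comp (h2.prodMk ((hc i).prodMk contDiff_snd))

end MultiphysicsSystem

theorem mainTheorem5 {m : ℕ} {V W : Fin m → Type}
    [∀ i, NormedAddCommGroup (V i)] [∀ i, NormedSpace ℝ (V i)] [∀ i, FiniteDimensional ℝ (V i)]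
    [∀ i, NormedAddCommGroup (W i)] [∀ i, NormedSpace ℝ (W i)] [∀ i, FiniteDimensional ℝ (W i)]
    (S : MultiphysicsSystem V W) (P : CouplingPredictor)
    {s : ℕ} (T : IMEXTableau s) (τ : Fin s → ℝ) :
    -- the velocity is split additively at the semi-discrete level, for any frozen data
    (∀ (ubar u : ∀ i, V i) (t : ℝ), S.fullVel u t = S.explVel P ubar u t + S.implVel P ubar u t) ∧
    -- the partitioned scheme is the IMEX-RK scheme for this splitting
    (∀ (t h : ℝ) (x : ∀ i, V i) (U Ke Ki : Fin s → ∀ i, V i) (y : ∀ i, V i),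
      S.PartitionedStep (T.withExplicitTimes τ) P t h x U Ke Ki y ↔
        IMEXStep (T.withExplicitTimes τ) S.monoMass (S.explVel P x) (S.implVel P x)
          t h x U Ke Ki y) ∧
    -- a scheme of order `p` keeps its local and its global order; the explicit stage times are
    -- those of the explicit tableau, or the implicit ones if these satisfy the row-sum condition
    (∀ p : ℕ, 1 ≤ p → T.HasOrder p →
      (τ = T.chat ∨ (τ = T.c ∧ ∀ j, T.c j = ∑ k ∈ Finset.Iic j, T.A j k)) →
      (∀ i, ContDiff ℝ ((p + 1 : ℕ) : WithTop ℕ∞)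
        (fun z : V i × W i × ℝ => S.vel i z.1 z.2.1 z.2.2)) →
      (∀ i, ContDiff ℝ ((p + 1 : ℕ) : WithTop ℕ∞)
        (fun z : (∀ k, V k) × ℝ => S.cpl i z.1 z.2)) →
      ∀ (Tf : ℝ) (u : ℝ → ∀ i, V i), 0 < Tf →
        SolvesODE S.monoMass S.fullVel u (Set.Icc 0 Tf) →
        ∃ C : ℝ, ∀ δ : ℝ, 0 < δ → ∃ h₀ : ℝ, 0 < h₀ ∧
          (∀ t h : ℝ, 0 ≤ t → 0 < h → h ≤ h₀ → t + h ≤ Tf →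
            (∃! y, S.StepsTo (T.withExplicitTimes τ) P δ t h (u t) y) ∧
            ∀ y, S.StepsTo (T.withExplicitTimes τ) P δ t h (u t) y →
              ‖y - u (t + h)‖ ≤ C * h ^ (p + 1)) ∧
          (∀ (N : ℕ) (tg : Fin (N + 1) → ℝ) (Δt : ℝ), tg 0 = 0 → tg (Fin.last N) = Tf →
            (∀ n : Fin N, tg n.castSucc < tg n.succ ∧ tg n.succ - tg n.castSucc ≤ Δt) →
            Δt ≤ h₀ →
            (∃! v, S.IsRun (T.withExplicitTimes τ) P δ tg (u 0) v) ∧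
            ∀ v, S.IsRun (T.withExplicitTimes τ) P δ tg (u 0) v →
              ∀ n, ‖v n - u (tg n)‖ ≤ C * Δt ^ p)) := by
  have hsplit : ∀ (ubar u : ∀ i, V i) (t : ℝ),
      S.fullVel u t = S.explVel P ubar u t + S.implVel P ubar u t := fun ubar u t => by
    simp only [MultiphysicsSystem.fullVel, MultiphysicsSystem.explVel,
      MultiphysicsSystem.implVel, sub_add_cancel]
  have hiff := S.partitionedStep_iff_imexStep P (T.withExplicitTimes τ)
  refine ⟨hsplit, hiff, fun p hp hT hτ hr hc Tf u hTf hu => ?_⟩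
  have hT' : (T.withExplicitTimes τ).HasOrder p := by
    rcases hτ with rfl | ⟨rfl, hrow⟩
    -- Restoring the tableau's own abscissae changes nothing, definitionally.
    · exact hT
    · exact hT.withExplicitTimes_c hrow
  have hg := S.contDiff_implVel P hr hc
  -- The explicit part is the full velocity minus the implicit part, jointly smooth also in the
  -- frozen data.
  have hf : ContDiff ℝ ((p + 1 : ℕ) : WithTop ℕ∞)
      (fun w : (∀ k, V k) × (∀ k, V k) × ℝ => S.explVel P w.1 w.2.1 w.2.2) :=
    ((S.contDiff_fullVel hr hc).comp contDiff_snd).sub hg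
  exact hT'.convergence hp hf hg hsplit hTf hu
    (Φ := fun δ t h x y => S.StepsTo (T.withExplicitTimes τ) P δ t h x y)
    (fun δ t h x y => by simp only [MultiphysicsSystem.StepsTo, hiff])
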